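/- Let $R$ be a simple left noetherian ring (associative, with $1$). A \emph{Sylvester matrix rank function} on a ring $S$ assigns to every matrix $A$ over $S$ a real number $\mathrm{rk}(A)\ge 0$ such that: $\mathrm{rk}(0)=0$ for every zero matrix and $\mathrm{rk}(1)=1$ for the $1\times 1$ identity matrix; $\mathrm{rk}(AB)\le\min\{\mathrm{rk}(A),\mathrm{rk}(B)\}$ whenever $AB$ is defined; $\mathrm{rk}\begin{pmatrix}A&0\\0&B\end{pmatrix}=\mathrm{rk}(A)+\mathrm{rk}(B)$; and $\mathrm{rk}\begin{pmatrix}A&C\\0&B\end{pmatrix}\ge\mathrm{rk}(A)+\mathrm{rk}(B)$ for $C$ of appropriate size. A \emph{Sylvester module rank function} on $S$ assigns to every finitely presented left $S$-module $M$ a real number $\dim(M)\ge 0$ such that: $\dim(0)=0$ and $\dim(S)=1$; $\dim(M_1\oplus M_2)=\dim(M_1)+\dim(M_2)$; and $\dim(M_1)+\dim(M_3)\ge\dim(M_2)\ge\dim(M_3)$ whenever $M_1\to M_2\to M_3\to 0$ is exact. The functions $\mathrm{rk}$ and $\dim$ are \emph{associated} if $\mathrm{rk}(A)=m-\dim(S^m/S^nA)$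 for every $n\times m$ matrix $A$ over $S$. Then the non-zero-divisors (elements that are neither left nor right zero divisors) of $R$ form a left Ore set, so that the classical left quotient ring $\mathcal Q_l(R)$, i.e. the ring of left fractions of $R$ with respect to all non-zero-divisors, exists; let $\varphi:R\to\mathcal Q_l(R)$ be the canonical homomorphism. The ring $\mathcal Q_l(R)$ is simple artinian. It has exactly one Sylvester matrix rank function $\mathrm{rk}_{\mathcal Q_l(R)}$ and exactly one Sylvester module rank function $\dim_{\mathcal Q_l(R)}$, and these two are associated. Moreover $R$ has exactly one Sylvester matrix rank function, namely the induced one $A\mapsto\mathrm{rk}_{\mathcal Q_l(R)}(\varphi(A))$, and exactly one Sylvester module rank function, and these two are associated. -/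

import Mathlib

open scoped nonZeroDivisors

universe u

/-- A Sylvester matrix rank function on a ring `R`: a non-negative real number for each matrix
over `R`, subject to the usual axioms. -/
@[ext]
structure SylvesterMatrixRank (R : Type u) [Ring R] where
  /-- the rank of a matrix -/
  rk : ∀ {m n : ℕ}, Matrix (Fin m) (Fin n) R → ℝ
  nonneg : ∀ {m n : ℕ} (A : Matrix (Fin m) (Fin n) R), 0 ≤ rk A
  rk_zero : ∀ m n : ℕ, rk (0 : Matrix (Fin m) (Fin n) R) = 0
  rk_one : rk (1 : Matrix (Fin 1) (Fin 1) R) = 1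
  rk_mul_le : ∀ {l m n : ℕ} (A : Matrix (Fin l) (Fin m) R) (B : Matrix (Fin m) (Fin n) R),
    rk (A * B) ≤ min (rk A) (rk B)
  rk_diag : ∀ {m n p q : ℕ} (A : Matrix (Fin m) (Fin n) R) (B : Matrix (Fin p) (Fin q) R),
    rk (Matrix.reindex finSumFinEquiv finSumFinEquiv (Matrix.fromBlocks A 0 0 B)) = rk A + rk B
  rk_triangular : ∀ {m n p q : ℕ} (A : Matrix (Fin m) (Fin n) R) (B : Matrix (Fin p) (Fin q) R)
    (C : Matrix (Fin m) (Fin q) R),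
    rk A + rk B ≤ rk (Matrix.reindex finSumFinEquiv finSumFinEquiv (Matrix.fromBlocks A C 0 B))

/-- A Sylvester module rank function on a ring `R`: a non-negative real number for each finitely
presented left `R`-module, subject to the usual axioms. Every finitely presented module over
`R : Type u` is isomorphic to one in `Type u`, and the axiom on exact sequences makes the value
invariant under isomorphism. -/
@[ext]
structure SylvesterModuleRank (R : Type u) [Ring R] where
  /-- the dimension of a finitely presented left module -/
  dim : ∀ (M : Type u) [AddCommGroup M] [Module R M] [Module.FinitePresentation R M], ℝ
  nonneg : ∀ (M : Type u) [AddCommGroup M] [Module R M] [Module.FinitePresentation R M],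
    0 ≤ dim M
  dim_zero : dim PUnit.{u + 1} = 0
  dim_self : dim R = 1
  dim_prod : ∀ (M₁ M₂ : Type u) [AddCommGroup M₁] [Module R M₁] [Module.FinitePresentation R M₁]
    [AddCommGroup M₂] [Module R M₂] [Module.FinitePresentation R M₂],
    dim (M₁ × M₂) = dim M₁ + dim M₂
  dim_exact : ∀ (M₁ M₂ M₃ : Type u)
    [AddCommGroup M₁] [Module R M₁] [Module.FinitePresentation R M₁]
    [AddCommGroup M₂] [Module R M₂] [Module.FinitePresentation R M₂]
    [AddCommGroup M₃] [Module R M₃] [Module.FinitePresentation R M₃]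
    (f : M₁ →ₗ[R] M₂) (g : M₂ →ₗ[R] M₃), Function.Exact f g → Function.Surjective g →
    dim M₂ ≤ dim M₁ + dim M₃ ∧ dim M₃ ≤ dim M₂

/-- The left `R`-module `R^m / R^n A` presented by an `n × m` matrix `A`, where `R^n` and `R^m`
consist of row vectors and `R^n A` is the submodule spanned by the rows of `A`. -/
abbrev PresentedModule {R : Type u} [Ring R] {n m : ℕ} (A : Matrix (Fin n) (Fin m) R) : Type u :=
  (Fin m → R) ⧸ LinearMap.range (Matrix.vecMulLinear A)

instance PresentedModule.finitePresentation {R : Type u} [Ring R] {n m : ℕ}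
    (A : Matrix (Fin n) (Fin m) R) : Module.FinitePresentation R (PresentedModule A) :=
  Module.finitePresentation_of_surjective _ (Submodule.mkQ_surjective _) (by
    rw [Submodule.ker_mkQ]
    exact Module.Finite.iff_fg.mp inferInstance)

/-- A matrix rank function and a module rank function are associated if
`rk A = m - dim (R^m / R^n A)` for every `n × m` matrix `A`. -/
def SylvesterMatrixRank.IsAssociated {R : Type u} [Ring R] (rk : SylvesterMatrixRank R)
    (d : SylvesterModuleRank R) : Prop :=
  ∀ (n m : ℕ) (A : Matrix (Fin n) (Fin m) R), rk.rk A = (m : ℝ) - d.dim (PresentedModule A)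

/-- The rank function on `R` induced by a rank function on `S` through a ring homomorphism
`φ : R → S`, namely `A ↦ rk (φ A)`. -/
def SylvesterMatrixRank.comap {R S : Type u} [Ring R] [Ring S] (φ : R →+* S)
    (rk : SylvesterMatrixRank S) : SylvesterMatrixRank R where
  rk A := rk.rk (A.map φ)
  nonneg A := rk.nonneg _
  rk_zero m n := by
    rw [Matrix.map_zero _ (map_zero φ)]
    exact rk.rk_zero m n
  rk_one := by
    rw [Matrix.map_one _ (map_zero φ) (map_one φ)]
    exact rk.rk_one
  rk_mul_le A B := by
    rw [Matrix.map_mul]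
    exact rk.rk_mul_le _ _
  rk_diag A B := by
    have h := rk.rk_diag (A.map φ) (B.map φ)
    rw [← h, Matrix.reindex_apply, Matrix.reindex_apply, ← Matrix.submatrix_map,
      Matrix.fromBlocks_map, Matrix.map_zero _ (map_zero φ), Matrix.map_zero _ (map_zero φ)]
  rk_triangular A B C := by
    have h := rk.rk_triangular (A.map φ) (B.map φ) (C.map φ)
    rw [Matrix.reindex_apply, ← Matrix.submatrix_map, Matrix.fromBlocks_map,
      Matrix.map_zero _ (map_zero φ)]
    exact h

/-- The classical left quotient ring of `R`: the ring of left fractions `s⁻¹ r` whose denominators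
are the two-sided non-zero-divisors of `R`, which are assumed to form a left Ore set. -/
abbrev ClassicalLeftQuotientRing (R : Type u) [Ring R] [OreLocalization.OreSet R⁰] : Type u :=
  OreLocalization R⁰ R

/-! Existence comes from Goldie's theorem. In a simple ring the singular elements form a proper
two-sided ideal, so the ring is nonsingular. With the noetherian condition, every essential left
ideal then contains a non-zero-divisor (`Submodule.Essential.exists_mem_nonZeroDivisors`). This
gives the Ore condition, and it forces every essential left ideal of the quotient ring to be the
whole ring, so that ring is semisimple, and simple by contraction of ideals. Normalized length of
row spaces is a matrix rank function on it, and it pulls back to `R`. Any matrix rank function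
yields an associated module rank function via presentations.

Uniqueness is proved once, for simple left noetherian rings, and so covers both rings. The crux is
`dim_eq_zero_of_singular`: a singular module of positive dimension would produce cyclic modules `R ⧸
J` of unbounded dimension, although each is a quotient of `R` and has dimension at most 1. Once
singular modules are negligible, `dim` is insensitive to essential extensions inside `R^n`, and
every finitely generated module has dimension `k * d.dim U`, where `U` is a fixed uniform left ideal
and `k` does not depend on `d`. The normalization `d.dim R = 1` fixes `d.dim U`. Matrix rank
functions are determined by their associated module rank functions. -/

/-! ### Essential submodules, singular and nonsingular modules -/

section Essential

variable {R M N : Type*} [Ring R] [AddCommGroup M] [Module R M] [AddCommGroup N] [Module R N]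

/-- A submodule is essential if it meets every non-zero cyclic submodule. -/
def Submodule.Essential (L : Submodule R M) : Prop :=
  ∀ m : M, m ≠ 0 → ∃ r : R, r • m ≠ 0 ∧ r • m ∈ L

theorem Submodule.Essential.mono {L L' : Submodule R M} (h : L.Essential) (hle : L ≤ L') :
    L'.Essential := fun m hm ↦
  let ⟨r, hr, hrL⟩ := h m hm
  ⟨r, hr, hle hrL⟩

theorem Submodule.Essential.inf {L L' : Submodule R M} (h : L.Essential) (h' : L'.Essential) :
    (L ⊓ L').Essential := fun m hm ↦ by
  obtain ⟨r, hr, hrL⟩ := h m hm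
  obtain ⟨s, hs, hsL⟩ := h' _ hr
  exact ⟨s * r, by rwa [mul_smul], by rw [mul_smul]; exact ⟨L.smul_mem s hrL, hsL⟩⟩

theorem Submodule.Essential.comap {L : Submodule R N} (h : L.Essential) (f : M →ₗ[R] N) :
    (L.comap f).Essential := fun m hm ↦ by
  by_cases hf : f m = 0
  · exact ⟨1, by rwa [one_smul], by simp [hf]⟩
  · obtain ⟨r, hr, hrL⟩ := h _ hf
    exact ⟨r, fun h0 ↦ hr (by rw [← map_smul, h0, map_zero]), by simpa using hrL⟩

theorem Submodule.Essential.eq_bot_of_disjoint {L L' : Submodule R M} (h : L.Essential)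
    (hd : Disjoint L L') : L' = ⊥ := by
  rw [Submodule.eq_bot_iff]
  intro m hm
  by_contra hne
  obtain ⟨r, hr, hrL⟩ := h m hne
  exact hr (Submodule.disjoint_def.mp hd _ hrL (L'.smul_mem r hm))

theorem Submodule.essential_of_forall_disjoint {L : Submodule R M}
    (h : ∀ L', Disjoint L L' → L' = ⊥) : L.Essential := by
  intro m hm
  by_contra! hne
  have := h (R ∙ m) (Submodule.disjoint_def.mpr fun x hx hxm ↦ by
    obtain ⟨r, rfl⟩ := Submodule.mem_span_singleton.mp hxm
    by_contra h0
    exact hne r h0 hx)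
  exact hm (Submodule.span_singleton_eq_bot.mp this)

theorem Submodule.exists_disjoint_sup_essential (L : Submodule R M) :
    ∃ C : Submodule R M, Disjoint L C ∧ (L ⊔ C).Essential := by
  obtain ⟨C, -, hC⟩ := zorn_le_nonempty₀ {C : Submodule R M | Disjoint L C}
    (fun c hc hchain y hy ↦ ⟨sSup c, (DirectedOn.disjoint_sSup_right hchain.directedOn).mpr
      fun b hb ↦ hc hb, fun z hz ↦ le_sSup hz⟩) ⊥ disjoint_bot_right
  refine ⟨C, hC.prop, Submodule.essential_of_forall_disjoint fun L' hL' ↦ ?_⟩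
  have h1 : Disjoint L (C ⊔ L') := hC.prop.disjoint_sup_right_of_disjoint_sup_left hL'
  have h2 : L' ≤ C := le_sup_right.trans (hC.le_of_ge h1 le_sup_left)
  exact (disjoint_self.mp (hL'.mono_left (h2.trans le_sup_right)))

variable (R M) in
/-- A module is singular if every element has an essential annihilator. -/
def Module.Singular : Prop := ∀ x : M, (LinearMap.ker (LinearMap.toSpanSingleton R M x)).Essential

variable (R M) in
/-- A module is nonsingular if only zero has an essential annihilator. -/
def Module.Nonsingular : Prop :=
  ∀ x : M, (LinearMap.ker (LinearMap.toSpanSingleton R M x)).Essential → x = 0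

theorem Submodule.Essential.singular_quotient {L : Submodule R M} (h : L.Essential) :
    Module.Singular R (M ⧸ L) := fun x ↦ by
  obtain ⟨x, rfl⟩ := L.mkQ_surjective x
  refine (h.comap (LinearMap.toSpanSingleton R M x)).mono fun r hr ↦ ?_
  rw [LinearMap.mem_ker, LinearMap.toSpanSingleton_apply, ← map_smul]
  exact (Submodule.Quotient.mk_eq_zero L).mpr hr

theorem Module.Singular.of_surjective (h : Module.Singular R M) {f : M →ₗ[R] N}
    (hf : Function.Surjective f) : Module.Singular R N := fun x ↦ by
  obtain ⟨x, rfl⟩ := hf x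
  refine (h x).mono fun r hr ↦ ?_
  simp only [LinearMap.mem_ker, LinearMap.toSpanSingleton_apply] at hr ⊢
  rw [← map_smul, hr, map_zero]

theorem Module.Nonsingular.pi {ι : Type*} (h : Module.Nonsingular R M) :
    Module.Nonsingular R (ι → M) := fun x hx ↦ by
  funext i
  refine h _ (hx.mono fun r hr ↦ ?_)
  simp only [LinearMap.mem_ker, LinearMap.toSpanSingleton_apply] at hr ⊢
  exact congrFun hr i

theorem Module.Nonsingular.exists_smul_ne_zero (h : Module.Nonsingular R M) {J : Ideal R}
    (hJ : J.Essential) {x : M} (hx : x ≠ 0) : ∃ r ∈ J, r • x ≠ 0 := by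
  by_contra! hc
  exact hx (h x (hJ.mono fun r hr ↦ by simpa using hc r hr))

/-- If `r • p = f a`, the multipliers carrying `a` into the range of `g` form an essential left
ideal; nonsingularity of the target keeps one of them from killing `r • p`. -/
theorem Module.Nonsingular.essential_range_comp {P : Type*} [AddCommGroup P] [Module R P]
    (h : Module.Nonsingular R P) {f : N →ₗ[R] P} {g : M →ₗ[R] N}
    (hf : (LinearMap.range f).Essential) (hg : (LinearMap.range g).Essential) :
    (LinearMap.range (f ∘ₗ g)).Essential := fun p hp ↦ by
  obtain ⟨r, hr, a, ha⟩ := hf p hp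
  obtain ⟨t, ⟨b, hb⟩, ht⟩ := h.exists_smul_ne_zero (hg.comap (LinearMap.toSpanSingleton R N a)) hr
  refine ⟨t * r, by rwa [mul_smul], b, ?_⟩
  rw [LinearMap.comp_apply, hb, LinearMap.toSpanSingleton_apply, map_smul, ha, mul_smul]

/-- Fitting's argument: for large `n` the kernel of `f ^ n` misses its range, which is essential, so
the kernel vanishes. -/
theorem Module.Nonsingular.injective_of_essential_range [IsNoetherian R M]
    (h : Module.Nonsingular R M) {f : Module.End R M} (hf : (LinearMap.range f).Essential) :
    Function.Injective f := by
  have hpow : ∀ n : ℕ, (LinearMap.range (f ^ n)).Essential := by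
    intro n
    induction n with
    | zero => exact fun m hm ↦ ⟨1, by simpa using hm, m, by simp⟩
    | succ n ih => rw [pow_succ']; exact h.essential_range_comp hf ih
  obtain ⟨n, hn⟩ := Filter.eventually_atTop.mp (f.eventually_disjoint_ker_pow_range_pow)
  have h1 := (hpow (n + 1)).eq_bot_of_disjoint (hn (n + 1) n.le_succ).symm
  rw [← LinearMap.ker_eq_bot, eq_bot_iff, ← h1, pow_succ]
  exact LinearMap.ker_le_ker_comp f (f ^ n)

/-- A submodule `L` missing the range would embed `M × L` in the noetherian module `M`, which forces
`L` to be zero. -/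
theorem LinearMap.essential_range_of_injective [IsNoetherian R M] {f : Module.End R M}
    (hf : Function.Injective f) : (LinearMap.range f).Essential := by
  refine Submodule.essential_of_forall_disjoint fun L hL ↦ ?_
  have hinj : Function.Injective (f.coprod L.subtype) := by
    rw [← LinearMap.ker_eq_bot, LinearMap.ker_coprod_of_disjoint_range]
    · simp [LinearMap.ker_eq_bot.mpr hf]
    · simpa using hL
  have e := IsNoetherian.equivPUnitOfProdInjective _ hinj
  have : Subsingleton L := e.toEquiv.subsingleton
  exact Submodule.subsingleton_iff_eq_bot.mp this

/-- Take `W` maximal among non-essential left ideals and `U` nonzero with `W ⊓ U = ⊥`. Adding a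
nonzero part of `U` to `W` makes it essential, so that part is essential in `U`. -/
theorem exists_uniform_ideal (R : Type*) [Ring R] [Nontrivial R] [IsNoetherianRing R] :
    ∃ U : Ideal R, U ≠ ⊥ ∧ ∀ A : Submodule R U, A ≠ ⊥ → A.Essential := by
  obtain ⟨W, hW, hmax⟩ := set_has_maximal_iff_noetherian.mpr ‹IsNoetherianRing R›
    {W : Ideal R | ¬ W.Essential}
    ⟨⊥, fun h ↦ let ⟨_, hr, hr'⟩ := h 1 one_ne_zero; hr hr'⟩
  obtain ⟨U, hWU, hU⟩ : ∃ U, Disjoint W U ∧ U ≠ ⊥ := by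
    by_contra! hc
    exact hW (Submodule.essential_of_forall_disjoint hc)
  refine ⟨U, hU, fun A hA ↦ ?_⟩
  have hlt : W < W ⊔ A.map U.subtype := by
    refine lt_of_le_of_ne le_sup_left fun h ↦ hA ?_
    have h1 : A.map U.subtype ≤ W := by rw [h]; exact le_sup_right
    have h2 : A.map U.subtype = ⊥ := le_bot_iff.mp (hWU h1 (Submodule.map_subtype_le U A))
    exact Submodule.map_injective_of_injective U.injective_subtype (h2.trans (Submodule.map_bot _).symm)
  have hess : (W ⊔ A.map U.subtype).Essential := not_not.mp fun h ↦ hmax _ h hlt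
  refine (hess.comap U.subtype).mono fun x hx ↦ ?_
  obtain ⟨w, hw, _, ⟨a, ha, rfl⟩, hwa⟩ := Submodule.mem_sup.mp hx
  have hw0 : w = 0 := Submodule.disjoint_def.mp hWU w hw (by
    rw [eq_sub_of_add_eq hwa]
    exact U.sub_mem x.2 a.2)
  rw [hw0, zero_add] at hwa
  rwa [← Subtype.ext hwa]

theorem Module.Nonsingular.injective_of_uniform (hN : Module.Nonsingular R N)
    (hM : ∀ A : Submodule R M, A ≠ ⊥ → A.Essential) {f : M →ₗ[R] N} (hf : f ≠ 0) :
    Function.Injective f := by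
  by_contra hinj
  refine hf (LinearMap.ext fun x ↦ hN _ ?_)
  have h := hM _ fun h ↦ hinj (LinearMap.ker_eq_bot.mp h)
  refine (h.comap (LinearMap.toSpanSingleton R M x)).mono fun r hr ↦ ?_
  simpa using hr

end Essential

/-! ### Goldie theory of simple left noetherian rings -/

section Goldie

variable (R : Type*) [Ring R] [IsSimpleRing R]

variable {R} in
-- The annihilator of `L` is two-sided, hence zero. This is how simplicity enters both the
-- construction of regular elements and the uniqueness proof.
theorem IsSimpleRing.exists_smul_ne_zero {M : Type*} [AddCommGroup M] [Module R M] {J : Ideal R}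
    (hJ : J ≠ ⊥) {L : Submodule R M} (hL : L ≠ ⊥) : ∃ r ∈ J, ∃ x ∈ L, r • x ≠ 0 := by
  by_contra! hc
  have hle : J ≤ Module.annihilator R L := fun r hr ↦
    Module.mem_annihilator.mpr fun x ↦ Subtype.ext (hc r hr x x.2)
  rcases (isSimpleRing_iff_isTwoSided_imp.mp ‹_›).2 (Module.annihilator R L) inferInstance
    with h | h
  · exact hJ (le_bot_iff.mp (h ▸ hle))
  · refine hL ((Submodule.eq_bot_iff _).mpr fun x hx ↦ ?_)
    have := Module.mem_annihilator.mp (h ▸ Submodule.mem_top : (1 : R) ∈ Module.annihilator R L)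
      ⟨x, hx⟩
    simpa using this

theorem IsSimpleRing.nonsingular : Module.Nonsingular R R := by
  let Z : Ideal R :=
    { carrier := {x | (LinearMap.ker (LinearMap.toSpanSingleton R R x)).Essential}
      zero_mem' := fun m hm ↦ ⟨1, by simpa using hm, by simp⟩
      add_mem' := fun {x y} hx hy ↦ (hx.inf hy).mono fun r hr ↦ by
        have h1 : r * x = 0 := by simpa using hr.1
        have h2 : r * y = 0 := by simpa using hr.2
        simp [mul_add, h1, h2]
      smul_mem' := fun c x hx ↦ (hx.comap (LinearMap.toSpanSingleton R R c)).mono fun r hr ↦ by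
        simpa [mul_assoc] using hr }
  have hZ : Z.IsTwoSided := ⟨fun {x} b (hx : Submodule.Essential _) ↦
    hx.mono fun r hr ↦ by
      have h1 : r * x = 0 := by simpa using hr
      simp [← mul_assoc, h1]⟩
  rcases (isSimpleRing_iff_isTwoSided_imp.mp ‹_›).2 Z hZ with h | h
  · intro x hx
    have : x ∈ Z := hx
    rwa [h, Submodule.mem_bot] at this
  · exfalso
    have h1 : (1 : R) ∈ Z := h ▸ Submodule.mem_top
    obtain ⟨r, hr, hr'⟩ := (h1 : Submodule.Essential _) 1 one_ne_zero
    exact hr (by simpa using hr')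

variable {R} [IsNoetherianRing R]

/-- Shrink the left annihilator of `x` step by step; the noetherian condition measures progress by a
left ideal `C` disjoint from it, maximal over all `x` in `E` at once. If the annihilator is nonzero,
`R x` is not essential, and `x` can be improved to `x + y` with `y` in `E` and in a left ideal
missing `R x`. -/
theorem Submodule.Essential.exists_injective_toSpanSingleton {E : Ideal R} (hE : E.Essential) :
    ∃ x ∈ E, Function.Injective (LinearMap.toSpanSingleton R R x) := by
  obtain ⟨C, ⟨x, hxE, hx⟩, hC⟩ := set_has_maximal_iff_noetherian.mpr ‹IsNoetherianRing R›
    {C : Ideal R | ∃ x ∈ E, Disjoint C (LinearMap.ker (LinearMap.toSpanSingleton R R x))}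
    ⟨⊥, 0, E.zero_mem, disjoint_bot_left⟩
  refine ⟨x, hxE, ?_⟩
  by_contra hinj
  have hker : LinearMap.ker (LinearMap.toSpanSingleton R R x) ≠ ⊥ := fun h ↦
    hinj (LinearMap.ker_eq_bot.mp h)
  have hess : ¬ (LinearMap.range (LinearMap.toSpanSingleton R R x)).Essential := fun h ↦
    hinj ((IsSimpleRing.nonsingular R).injective_of_essential_range h)
  obtain ⟨L, hdisj, hL⟩ : ∃ L, Disjoint (LinearMap.range (LinearMap.toSpanSingleton R R x)) L ∧
      L ≠ ⊥ := by
    by_contra! hc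
    exact hess (Submodule.essential_of_forall_disjoint hc)
  have hLE : L ⊓ E ≠ ⊥ := fun h ↦ hL (hE.eq_bot_of_disjoint (disjoint_iff.mpr (inf_comm E L ▸ h)))
  -- `a` kills `x` but not `y`. A nonzero `t` with `R t` missing the annihilator of `a • y` will
  -- then make `C ⊔ R ∙ (t * a)` disjoint from the annihilator of `x + y`.
  obtain ⟨a, ha, y, ⟨hyL, hyE⟩, hay⟩ := IsSimpleRing.exists_smul_ne_zero hker hLE
  have hay' : ¬ (LinearMap.ker (LinearMap.toSpanSingleton R R (a • y))).Essential := fun h ↦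
    hay (IsSimpleRing.nonsingular R _ h)
  simp only [Submodule.Essential, not_forall, not_exists, not_and] at hay'
  obtain ⟨t, ht, hta⟩ := hay'
  have hker_add : ∀ r : R, r * (x + y) = 0 → r * x = 0 ∧ r * y = 0 := by
    intro r hr
    rw [mul_add] at hr
    have h1 : r * x = 0 := Submodule.disjoint_def.mp hdisj _ ⟨r, by simp⟩ (by
      rw [eq_neg_of_add_eq_zero_left hr]
      exact L.neg_mem (L.smul_mem r hyL))
    exact ⟨h1, by simpa [h1] using hr⟩
  have hax : a * x = 0 := by simpa using ha
  refine hC (C ⊔ R ∙ (t * a)) ⟨x + y, E.add_mem hxE hyE, ?_⟩ ?_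
  · rw [Submodule.disjoint_def]
    intro z hz hz0
    obtain ⟨c, hc, z', hz', rfl⟩ := Submodule.mem_sup.mp hz
    obtain ⟨r, rfl⟩ := Submodule.mem_span_singleton.mp hz'
    obtain ⟨h1, h2⟩ := hker_add _ (by simpa using hz0)
    have hc0 : c = 0 := Submodule.disjoint_def.mp hx c hc (by
      have : r * (t * a) * x = 0 := by rw [mul_assoc, mul_assoc, hax, mul_zero, mul_zero]
      simpa [add_mul, this] using h1)
    subst hc0
    by_contra hne
    have hrt : r • t ≠ 0 := fun h ↦ hne (by
      rw [smul_eq_mul] at h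
      rw [zero_add, smul_eq_mul, ← mul_assoc, h, zero_mul])
    refine hta r hrt ?_
    simpa [mul_assoc] using h2
  · refine lt_of_le_of_ne le_sup_left fun h ↦ ?_
    have hmem : t * a ∈ C := h ▸ Submodule.mem_sup_right (Submodule.mem_span_singleton_self _)
    have h0 := Submodule.disjoint_def.mp hx _ hmem (by simp [mul_assoc, hax])
    exact hta 1 (by simpa using ht) (by simp [← mul_assoc, h0])

/-- One-sided regularity suffices: `R x` is essential, so if `x * y = 0` then `y` has an essential
annihilator. -/
theorem IsSimpleRing.mem_nonZeroDivisors_of_injective {x : R}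
    (hx : Function.Injective (LinearMap.toSpanSingleton R R x)) : x ∈ R⁰ := by
  refine ⟨fun y hy ↦ ?_, fun y hy ↦ hx (by simpa using hy)⟩
  by_contra hy0
  obtain ⟨r, ⟨s, rfl⟩, hr⟩ := (IsSimpleRing.nonsingular R).exists_smul_ne_zero
    (LinearMap.essential_range_of_injective hx) hy0
  exact hr (by simp [mul_assoc, hy])

theorem Submodule.Essential.exists_mem_nonZeroDivisors {E : Ideal R} (hE : E.Essential) :
    ∃ x ∈ E, x ∈ R⁰ :=
  let ⟨x, hxE, hx⟩ := hE.exists_injective_toSpanSingleton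
  ⟨x, hxE, IsSimpleRing.mem_nonZeroDivisors_of_injective hx⟩

theorem injective_toSpanSingleton_of_mem_nonZeroDivisors {R : Type*} [Ring R] {s : R}
    (hs : s ∈ R⁰) : Function.Injective (LinearMap.toSpanSingleton R R s) :=
  (injective_iff_map_eq_zero _).mpr fun r hr ↦ hs.2 r (by simpa using hr)

theorem essential_range_of_mem_nonZeroDivisors {R : Type*} [Ring R] [IsNoetherianRing R] {s : R}
    (hs : s ∈ R⁰) : (LinearMap.range (LinearMap.toSpanSingleton R R s)).Essential :=
  LinearMap.essential_range_of_injective (injective_toSpanSingleton_of_mem_nonZeroDivisors hs)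

variable (R) in
-- The left ideal of all `t` with `t * r` in `R s` is essential, so it supplies a regular
-- denominator.
theorem IsSimpleRing.nonempty_oreSet : Nonempty (OreLocalization.OreSet R⁰) := by
  refine OreLocalization.nonempty_oreSet_iff.mpr ⟨fun r₁ r₂ s h ↦ ⟨1, ?_⟩, fun r s ↦ ?_⟩
  · rw [injective_toSpanSingleton_of_mem_nonZeroDivisors s.2 (a₁ := r₁) (a₂ := r₂) (by simpa using h)]
  · obtain ⟨t, ⟨r', hr'⟩, ht⟩ := ((essential_range_of_mem_nonZeroDivisors s.2).comap
      (LinearMap.toSpanSingleton R R r)).exists_mem_nonZeroDivisors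
    exact ⟨r', ⟨t, ht⟩, by simpa using hr'.symm⟩

end Goldie

/-! ### The quotient ring is simple and semisimple -/

section ClassicalQuotient

open OreLocalization

variable {R : Type u} [Ring R] [OreLocalization.OreSet R⁰]

local notation "φ" => (numeratorRingHom : R →+* ClassicalLeftQuotientRing R)

theorem ClassicalLeftQuotientRing.exists_mul_eq (q : ClassicalLeftQuotientRing R) :
    ∃ (s : R⁰) (r : R), φ s * q = φ r := by
  induction q using OreLocalization.ind with
  | _ r s => exact ⟨s, r, OreLocalization.mul_cancel⟩

theorem ClassicalLeftQuotientRing.isUnit_numerator (s : R⁰) : IsUnit (φ s) :=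
  numerator_isUnit s

theorem ClassicalLeftQuotientRing.injective_numerator : Function.Injective φ :=
  numeratorHom_inj inf_le_left

theorem ClassicalLeftQuotientRing.eq_top_of_mem {I : Ideal (ClassicalLeftQuotientRing R)} {s : R}
    (hs : s ∈ R⁰) (h : φ s ∈ I) : I = ⊤ :=
  I.eq_top_of_isUnit_mem h (isUnit_numerator ⟨s, hs⟩)

variable [IsSimpleRing R]

instance ClassicalLeftQuotientRing.isSimpleRing : IsSimpleRing (ClassicalLeftQuotientRing R) := by
  refine isSimpleRing_iff_isTwoSided_imp.mpr ⟨inferInstance, fun I hI ↦ ?_⟩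
  have : (I.comap φ).IsTwoSided := inferInstance
  rcases (isSimpleRing_iff_isTwoSided_imp.mp ‹IsSimpleRing R›).2 (I.comap φ) this with h | h
  · left
    rw [Submodule.eq_bot_iff]
    intro q hq
    obtain ⟨s, r, hsr⟩ := exists_mul_eq q
    have hr : r ∈ I.comap φ := by
      rw [Ideal.mem_comap, ← hsr]
      exact I.mul_mem_left _ hq
    rw [h, Submodule.mem_bot] at hr
    rw [hr, map_zero] at hsr
    exact ((isUnit_numerator s).mul_right_eq_zero).mp hsr
  · right
    refine eq_top_of_mem (s := 1) (one_mem _) ?_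
    exact (Ideal.mem_comap (f := φ)).mp (h ▸ Submodule.mem_top)

variable [IsNoetherianRing R]

theorem ClassicalLeftQuotientRing.eq_top_of_essential {I : Ideal (ClassicalLeftQuotientRing R)}
    (hI : I.Essential) : I = ⊤ := by
  have hJ : (I.comap φ : Ideal R).Essential := by
    intro m hm
    obtain ⟨q, hq, hqI⟩ := hI (φ m) fun h ↦ hm (injective_numerator (h.trans (map_zero φ).symm))
    obtain ⟨s, r, hsr⟩ := exists_mul_eq q
    have h1 : φ (r * m) = φ s * (q * φ m) := by rw [map_mul, ← hsr, mul_assoc]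
    refine ⟨r, fun h ↦ hq ?_, ?_⟩
    · rw [← smul_eq_mul r m, h, map_zero] at h1
      exact ((isUnit_numerator s).mul_right_eq_zero).mp h1.symm
    · rw [Ideal.mem_comap, smul_eq_mul, h1]
      exact I.mul_mem_left _ hqI
  obtain ⟨s, hs, hs'⟩ := hJ.exists_mem_nonZeroDivisors
  exact eq_top_of_mem hs' hs

instance ClassicalLeftQuotientRing.isSemisimpleRing :
    IsSemisimpleRing (ClassicalLeftQuotientRing R) where
  -- A left ideal plus a maximal disjoint one is essential, hence everything.
  exists_isCompl I :=
    let ⟨C, hC, h⟩ := I.exists_disjoint_sup_essential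
    ⟨C, hC, codisjoint_iff.mpr (eq_top_of_essential h)⟩

end ClassicalQuotient

/-! ### Matrix rank functions over arbitrary finite index types -/

section MatrixRank

open Matrix

namespace SylvesterMatrixRank

variable {R : Type u} [Ring R] (rk : SylvesterMatrixRank R)

/-- Selecting rows and columns is multiplication by 0-1 matrices; invariance under reindexing
follows from this. -/
theorem rk_submatrix_le {m n p q : ℕ} (A : Matrix (Fin m) (Fin n) R) (f : Fin p → Fin m)
    (g : Fin q → Fin n) : rk.rk (A.submatrix f g) ≤ rk.rk A := by
  have h : A.submatrix f g = (1 : Matrix (Fin m) (Fin m) R).submatrix f id * A *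
      (1 : Matrix (Fin n) (Fin n) R).submatrix id g := by
    ext i j
    simp [Matrix.mul_apply, Matrix.one_apply]
  rw [h]
  exact (rk.rk_mul_le _ _).trans ((min_le_left _ _).trans ((rk.rk_mul_le _ _).trans
    (min_le_right _ _)))

variable {ι κ μ ι' κ' : Type*} [Fintype ι] [Fintype κ] [Fintype μ] [Fintype ι'] [Fintype κ']

/-- The rank of a matrix whose rows and columns are indexed by arbitrary finite types. -/
noncomputable def rank (A : Matrix ι κ R) : ℝ :=
  rk.rk (A.submatrix (Fintype.equivFin ι).symm (Fintype.equivFin κ).symm)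

theorem rank_eq_rk {m n : ℕ} (A : Matrix ι κ R) (e : Fin m ≃ ι) (f : Fin n ≃ κ) :
    rk.rank A = rk.rk (A.submatrix e f) := by
  refine le_antisymm ?_ ?_
  · have h := rk.rk_submatrix_le (A.submatrix e f) ((Fintype.equivFin ι).symm.trans e.symm)
      ((Fintype.equivFin κ).symm.trans f.symm)
    simpa [Matrix.submatrix_submatrix, Function.comp_def, rank] using h
  · have h := rk.rk_submatrix_le (A.submatrix (Fintype.equivFin ι).symm (Fintype.equivFin κ).symm)
      (e.trans (Fintype.equivFin ι)) (f.trans (Fintype.equivFin κ))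
    simpa [Matrix.submatrix_submatrix, Function.comp_def, rank] using h

theorem rank_fin {m n : ℕ} (A : Matrix (Fin m) (Fin n) R) : rk.rank A = rk.rk A :=
  rk.rank_eq_rk A (Equiv.refl _) (Equiv.refl _)

theorem rank_submatrix_equiv (A : Matrix ι κ R) (e : ι' ≃ ι) (f : κ' ≃ κ) :
    rk.rank (A.submatrix e f) = rk.rank A :=
  (rk.rank_eq_rk A ((Fintype.equivFin ι').symm.trans e)
    ((Fintype.equivFin κ').symm.trans f)).symm

theorem rank_mul_le_left (A : Matrix ι κ R) (B : Matrix κ μ R) :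
    rk.rank (A * B) ≤ rk.rank A := by
  rw [rank, ← Matrix.submatrix_mul_equiv A B _ (Fintype.equivFin κ).symm]
  exact (rk.rk_mul_le _ _).trans (min_le_left _ _)

theorem rank_mul_le_right (A : Matrix ι κ R) (B : Matrix κ μ R) :
    rk.rank (A * B) ≤ rk.rank B := by
  rw [rank, ← Matrix.submatrix_mul_equiv A B _ (Fintype.equivFin κ).symm]
  exact (rk.rk_mul_le _ _).trans (min_le_right _ _)

theorem rank_zero : rk.rank (0 : Matrix ι κ R) = 0 := rk.rk_zero _ _

theorem rank_fromBlocks_diag (A : Matrix ι κ R) (B : Matrix ι' κ' R) :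
    rk.rank (fromBlocks A 0 0 B) = rk.rank A + rk.rank B := by
  rw [rk.rank_eq_rk _
    (finSumFinEquiv.symm.trans (Equiv.sumCongr (Fintype.equivFin ι).symm (Fintype.equivFin ι').symm))
    (finSumFinEquiv.symm.trans (Equiv.sumCongr (Fintype.equivFin κ).symm (Fintype.equivFin κ').symm)),
    rank, rank, ← rk.rk_diag]
  congr 1
  ext i j
  refine Fin.addCases (fun i ↦ ?_) (fun i ↦ ?_) i <;>
  refine Fin.addCases (fun j ↦ ?_) (fun j ↦ ?_) j <;> simp

theorem rank_add_rank_le (A : Matrix ι κ R) (B : Matrix ι' κ' R) (C : Matrix ι κ' R) :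
    rk.rank A + rk.rank B ≤ rk.rank (fromBlocks A C 0 B) := by
  rw [rk.rank_eq_rk (fromBlocks A C 0 B)
    (finSumFinEquiv.symm.trans (Equiv.sumCongr (Fintype.equivFin ι).symm (Fintype.equivFin ι').symm))
    (finSumFinEquiv.symm.trans (Equiv.sumCongr (Fintype.equivFin κ).symm (Fintype.equivFin κ').symm))]
  refine (rk.rk_triangular _ _ (C.submatrix (Fintype.equivFin ι).symm
    (Fintype.equivFin κ').symm)).trans_eq ?_
  congr 1
  ext i j
  refine Fin.addCases (fun i ↦ ?_) (fun i ↦ ?_) i <;>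
  refine Fin.addCases (fun j ↦ ?_) (fun j ↦ ?_) j <;> simp

theorem rank_add_rank_le_lower (A : Matrix ι κ R) (B : Matrix ι' κ' R) (C : Matrix ι' κ R) :
    rk.rank A + rk.rank B ≤ rk.rank (fromBlocks A 0 C B) := by
  rw [← rk.rank_submatrix_equiv (fromBlocks A 0 C B) (Equiv.sumComm _ _) (Equiv.sumComm _ _),
    add_comm]
  refine (rk.rank_add_rank_le B A C).trans_eq ?_
  congr 1
  exact (fromBlocks_submatrix_sum_swap_sum_swap A 0 C B).symm

theorem rk_one_eq (n : ℕ) : rk.rk (1 : Matrix (Fin n) (Fin n) R) = n := by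
  induction n with
  | zero => simpa [Subsingleton.elim (1 : Matrix (Fin 0) (Fin 0) R) 0] using rk.rk_zero 0 0
  | succ n ih =>
    rw [Nat.cast_succ, ← ih, ← rk.rk_one, ← rk.rk_diag, fromBlocks_one]
    simp

theorem rank_one [DecidableEq ι] : rk.rank (1 : Matrix ι ι R) = Fintype.card ι := by
  rw [rank, Matrix.submatrix_one_equiv, rk_one_eq]

theorem rank_le_card (A : Matrix ι κ R) : rk.rank A ≤ Fintype.card κ := by
  classical
  rw [← rk.rank_one (ι := κ)]
  simpa using rk.rank_mul_le_right A (1 : Matrix κ κ R)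

/-- The hypotheses factor the block matrix with rows `(L, 0)` and `(T, 1)` through `diag(1, A)`.
Both inequalities between dimensions of presented modules reduce to this. -/
theorem rank_add_card_le [DecidableEq κ] [DecidableEq μ] {L : Matrix ι κ R} {W : Matrix κ μ R}
    {P : Matrix ι ι' R} {A : Matrix ι' μ R} {T : Matrix μ κ R} {V : Matrix μ ι' R}
    (h0 : L * W + P * A = 0) (h1 : T * W + V * A = 1) :
    rk.rank L + Fintype.card μ ≤ Fintype.card κ + rk.rank A := by
  have h : fromBlocks L P T V * (fromBlocks (1 : Matrix κ κ R) 0 0 A *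
      fromBlocks (1 : Matrix κ κ R) W 0 (1 : Matrix μ μ R)) =
      fromBlocks L 0 T 1 := by
    simp [fromBlocks_multiply, h0, h1]
  have h1 := rk.rank_add_rank_le_lower L (1 : Matrix μ μ R) T
  have h2 := rk.rank_fromBlocks_diag (1 : Matrix κ κ R) A
  rw [rank_one] at h1 h2
  rw [← h2]
  refine h1.trans ?_
  rw [← h]
  exact (rk.rank_mul_le_right _ _).trans (rk.rank_mul_le_left _ _)

end SylvesterMatrixRank

/-! ### Presentations of modules by matrices -/

section Presentation

variable {R : Type u} [Ring R] {M N : Type*} [AddCommGroup M] [Module R M] [AddCommGroup N]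
  [Module R N] {ι κ ι' κ' : Type*} [Fintype ι] [Fintype ι']

/-- The matrix `A` presents the module `M` through the surjection `p`. -/
structure Matrix.IsPresentation (A : Matrix ι κ R) (p : (κ → R) →ₗ[R] M) : Prop where
  surjective : Function.Surjective p
  exact : Function.Exact A.vecMulLinear p

theorem exists_vecMul_lift (h : (ι → R) →ₗ[R] M) (q : (κ → R) →ₗ[R] M)
    (hq : ∀ x, ∃ y, q y = h x) : ∃ F : Matrix ι κ R, ∀ x, q (x ᵥ* F) = h x := by
  classical
  choose g hg using hq
  refine ⟨Matrix.of fun i ↦ g (Pi.single i 1), fun x ↦ ?_⟩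
  have : q ∘ₗ (Matrix.of fun i ↦ g (Pi.single i 1)).vecMulLinear = h := by
    refine (Pi.basisFun R ι).ext fun i ↦ ?_
    rw [Pi.basisFun_apply, LinearMap.comp_apply, vecMulLinear_apply, single_one_vecMul, ← hg]
    rfl
  exact LinearMap.congr_fun this x

theorem Matrix.IsPresentation.exists_mul_eq {A : Matrix ι κ R} {p : (κ → R) →ₗ[R] M}
    (hA : A.IsPresentation p) (B : Matrix ι' κ R) (hB : ∀ x, p (x ᵥ* B) = 0) :
    ∃ X : Matrix ι' ι R, X * A = B := by
  classical
  obtain ⟨X, hX⟩ := exists_vecMul_lift B.vecMulLinear A.vecMulLinear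
    fun x ↦ (hA.exact _).mp (hB x)
  refine ⟨X, Matrix.toLinearMapRight'.injective (LinearMap.ext fun x ↦ ?_)⟩
  simpa using hX x

theorem Module.FinitePresentation.exists_isPresentation (R : Type u) [Ring R] (M : Type*)
    [AddCommGroup M] [Module R M] [Module.FinitePresentation R M] :
    ∃ (n m : ℕ) (A : Matrix (Fin n) (Fin m) R) (p : (Fin m → R) →ₗ[R] M),
      A.IsPresentation p := by
  obtain ⟨n, m, f, g, hf, hg⟩ := Module.FinitePresentation.exists_fin' R M
  refine ⟨m, n, LinearMap.toMatrixRight' g, f, hf, ?_⟩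
  have : (LinearMap.toMatrixRight' g).vecMulLinear = g :=
    LinearMap.toMatrixRight'.symm_apply_apply g
  rwa [this]

theorem PresentedModule.isPresentation {n m : ℕ} (A : Matrix (Fin n) (Fin m) R) :
    A.IsPresentation (LinearMap.range A.vecMulLinear).mkQ :=
  ⟨Submodule.mkQ_surjective _, LinearMap.exact_iff.mpr (Submodule.ker_mkQ _)⟩

theorem Matrix.IsPresentation.prod {A : Matrix ι κ R} {p : (κ → R) →ₗ[R] M}
    (hA : A.IsPresentation p) {B : Matrix ι' κ' R} {q : (κ' → R) →ₗ[R] N}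
    (hB : B.IsPresentation q) :
    (fromBlocks A 0 0 B).IsPresentation
      ((p ∘ₗ LinearMap.funLeft R R Sum.inl).prod (q ∘ₗ LinearMap.funLeft R R Sum.inr)) := by
  refine ⟨fun ⟨x, y⟩ ↦ ?_, fun z ↦ ⟨fun hz ↦ ?_, ?_⟩⟩
  · obtain ⟨a, rfl⟩ := hA.surjective x
    obtain ⟨b, rfl⟩ := hB.surjective y
    exact ⟨Sum.elim a b, rfl⟩
  · obtain ⟨h1, h2⟩ := Prod.ext_iff.mp hz
    obtain ⟨a, ha⟩ := (hA.exact _).mp h1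
    obtain ⟨b, hb⟩ := (hB.exact _).mp h2
    refine ⟨Sum.elim a b, ?_⟩
    rw [vecMulLinear_apply] at ha hb ⊢
    rw [vecMul_fromBlocks]
    simp only [Sum.elim_comp_inl, Sum.elim_comp_inr, vecMul_zero, add_zero, zero_add, ha, hb]
    exact Sum.elim_comp_inl_inr z
  · rintro ⟨x, rfl⟩
    rw [vecMulLinear_apply, vecMul_fromBlocks, vecMul_zero, vecMul_zero, add_zero, zero_add]
    exact Prod.ext (hA.exact.apply_apply_eq_zero _) (hB.exact.apply_apply_eq_zero _)

end Presentation

/-! ### From matrix rank functions to module rank functions -/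

namespace SylvesterMatrixRank

variable {R : Type u} [Ring R] (rk : SylvesterMatrixRank R) {M₁ M₂ M₃ : Type*}
  [AddCommGroup M₁] [Module R M₁] [AddCommGroup M₂] [Module R M₂] [AddCommGroup M₃] [Module R M₃]
  {ι₁ ι₂ ι₃ κ₁ κ₂ κ₃ : Type*} [Fintype ι₁] [Fintype ι₂] [Fintype ι₃] [Fintype κ₁] [Fintype κ₂]
  [Fintype κ₃] {A₁ : Matrix ι₁ κ₁ R} {A₂ : Matrix ι₂ κ₂ R} {A₃ : Matrix ι₃ κ₃ R}
  {p₁ : (κ₁ → R) →ₗ[R] M₁} {p₂ : (κ₂ → R) →ₗ[R] M₂} {p₃ : (κ₃ → R) →ₗ[R] M₃}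

theorem card_sub_rank_le_add (h₁ : A₁.IsPresentation p₁) (h₂ : A₂.IsPresentation p₂)
    (h₃ : A₃.IsPresentation p₃) {f : M₁ →ₗ[R] M₂} {g : M₂ →ₗ[R] M₃} (hfg : Function.Exact f g)
    (hg : Function.Surjective g) :
    Fintype.card κ₂ - rk.rank A₂ ≤
      (Fintype.card κ₁ - rk.rank A₁) + (Fintype.card κ₃ - rk.rank A₃) := by
  classical
  obtain ⟨F, hF⟩ := exists_vecMul_lift (f ∘ₗ p₁) p₂ fun x ↦ h₂.surjective _
  obtain ⟨G, hG⟩ := exists_vecMul_lift (g ∘ₗ p₂) p₃ fun x ↦ h₃.surjective _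
  obtain ⟨H, hH⟩ := exists_vecMul_lift p₃ (g ∘ₗ p₂) fun x ↦ (hg.comp h₂.surjective) _
  have hker : ∀ y, g (p₂ y) = 0 → ∃ z, f (p₁ z) = p₂ y := fun y hy ↦ by
    obtain ⟨w, hw⟩ := (hfg _).mp hy
    obtain ⟨z, rfl⟩ := h₁.surjective w
    exact ⟨z, hw⟩
  obtain ⟨X, hX⟩ := h₂.exists_mul_eq (A₁ * F) fun x ↦ by
    rw [← vecMul_vecMul, hF, LinearMap.comp_apply, ← vecMulLinear_apply,
      h₁.exact.apply_apply_eq_zero, map_zero]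
  obtain ⟨Y, hY⟩ := exists_vecMul_lift (p₂ ∘ₗ (A₃ * H).vecMulLinear) (f ∘ₗ p₁) fun x ↦ by
    refine hker _ ?_
    rw [vecMulLinear_apply, ← vecMul_vecMul]
    refine (hH _).trans ?_
    rw [← vecMulLinear_apply, h₃.exact.apply_apply_eq_zero]
  obtain ⟨Z, hZ⟩ := h₂.exists_mul_eq (A₃ * H - Y * F) fun x ↦ by
    rw [vecMul_sub, map_sub, ← vecMul_vecMul x Y, hF, hY]
    simp
  obtain ⟨U, hU⟩ := exists_vecMul_lift (p₂ ∘ₗ (1 - G * H).vecMulLinear) (f ∘ₗ p₁) fun x ↦ by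
    refine hker _ ?_
    rw [vecMulLinear_apply, vecMul_sub, vecMul_one, map_sub, map_sub, ← vecMul_vecMul, sub_eq_zero]
    exact ((hH _).trans (hG x)).symm
  obtain ⟨V, hV⟩ := h₂.exists_mul_eq (1 - G * H - U * F) fun x ↦ by
    rw [vecMul_sub, map_sub, ← vecMul_vecMul x U, hF, hU, LinearMap.comp_apply,
      vecMulLinear_apply, sub_self]
  -- As in the horseshoe lemma, the rows of `F` and `H` jointly generate `M₂` modulo `A₂`, and the
  -- rows of `L` are relations among these generators; `-Y` corrects the lifted relations of `M₃`.
  have key := rk.rank_add_card_le (L := fromBlocks A₁ 0 (-Y) A₃) (W := fromRows F H)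
    (P := fromRows (-X) (-Z)) (A := A₂) (T := fromCols U G) (V := V) (by
      rw [fromBlocks_mul_fromRows, fromRows_mul]
      ext (i | i) j
      · simp [hX]
      · simp [hZ]) (by
      rw [fromCols_mul_fromRows, hV]
      abel)
  have := rk.rank_add_rank_le_lower A₁ A₃ (-Y)
  rw [Fintype.card_sum, Nat.cast_add] at key
  linarith

theorem card_sub_rank_le (h₂ : A₂.IsPresentation p₂) (h₃ : A₃.IsPresentation p₃)
    {g : M₂ →ₗ[R] M₃} (hg : Function.Surjective g) :
    Fintype.card κ₃ - rk.rank A₃ ≤ Fintype.card κ₂ - rk.rank A₂ := by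
  classical
  obtain ⟨G, hG⟩ := exists_vecMul_lift (g ∘ₗ p₂) p₃ fun x ↦ h₃.surjective _
  obtain ⟨H, hH⟩ := exists_vecMul_lift p₃ (g ∘ₗ p₂) fun x ↦ (hg.comp h₂.surjective) _
  obtain ⟨X, hX⟩ := h₃.exists_mul_eq (A₂ * G) fun x ↦ by
    rw [← vecMul_vecMul, hG, LinearMap.comp_apply, ← vecMulLinear_apply,
      h₂.exact.apply_apply_eq_zero, map_zero]
  obtain ⟨Y, hY⟩ := h₃.exists_mul_eq (1 - H * G) fun x ↦ by
    rw [vecMul_sub, map_sub, vecMul_one, ← vecMul_vecMul, hG, hH, sub_self]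
  have key := rk.rank_add_card_le (L := A₂) (W := G) (P := -X) (A := A₃) (T := H) (V := Y)
    (by rw [Matrix.neg_mul, hX, add_neg_cancel]) (by rw [hY]; abel)
  linarith

/-- Monotonicity under the identity, applied both ways, makes the dimension independent of the
presentation. -/
theorem card_sub_rank_congr {M : Type*} [AddCommGroup M] [Module R M]
    {p₁ : (κ₁ → R) →ₗ[R] M} {p₂ : (κ₂ → R) →ₗ[R] M} (h₁ : A₁.IsPresentation p₁)
    (h₂ : A₂.IsPresentation p₂) :
    (Fintype.card κ₁ : ℝ) - rk.rank A₁ = Fintype.card κ₂ - rk.rank A₂ :=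
  le_antisymm (rk.card_sub_rank_le h₂ h₁ (g := LinearMap.id) Function.surjective_id)
    (rk.card_sub_rank_le h₁ h₂ (g := LinearMap.id) Function.surjective_id)

/-- The dimension of a finitely presented module, computed from a presentation. -/
noncomputable def moduleDim (M : Type*) [AddCommGroup M] [Module R M]
    [Module.FinitePresentation R M] : ℝ :=
  (Module.FinitePresentation.exists_isPresentation R M).choose_spec.choose -
    rk.rk (Module.FinitePresentation.exists_isPresentation R M).choose_spec.choose_spec.choose

theorem moduleDim_eq {M : Type*} [AddCommGroup M] [Module R M] [Module.FinitePresentation R M]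
    {p : (κ₁ → R) →ₗ[R] M} (h : A₁.IsPresentation p) :
    rk.moduleDim M = Fintype.card κ₁ - rk.rank A₁ := by
  obtain ⟨q, hq⟩ :=
    (Module.FinitePresentation.exists_isPresentation R M).choose_spec.choose_spec.choose_spec
  simpa [moduleDim, rank_fin] using rk.card_sub_rank_congr hq h

/-- The module rank function associated to a matrix rank function. -/
noncomputable def toModuleRank : SylvesterModuleRank R where
  dim M := rk.moduleDim M
  nonneg M _ _ _ := by
    obtain ⟨n, m, A, p, h⟩ := Module.FinitePresentation.exists_isPresentation R M
    rw [rk.moduleDim_eq h]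
    exact sub_nonneg.mpr (rk.rank_le_card A)
  dim_zero := by
    have h : (0 : Matrix (Fin 0) (Fin 0) R).IsPresentation (0 : (Fin 0 → R) →ₗ[R] PUnit.{u + 1}) :=
      ⟨fun x ↦ ⟨0, rfl⟩, fun x ↦ ⟨fun _ ↦ ⟨0, Subsingleton.elim _ _⟩, fun _ ↦ rfl⟩⟩
    simp [rk.moduleDim_eq h, rank_zero]
  dim_self := by
    have h : (0 : Matrix (Fin 0) (Fin 1) R).IsPresentation (LinearMap.proj 0) :=
      ⟨fun x ↦ ⟨fun _ ↦ x, rfl⟩, fun x ↦ ⟨fun hx ↦ ⟨0, funext fun i ↦ by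
        rw [Subsingleton.elim i 0]; simpa using Eq.symm hx⟩, by rintro ⟨y, rfl⟩; simp⟩⟩
    simp [rk.moduleDim_eq h, rank_zero]
  dim_prod M₁ M₂ _ _ _ _ _ _ := by
    obtain ⟨n, m, A, p, h⟩ := Module.FinitePresentation.exists_isPresentation R M₁
    obtain ⟨n', m', A', p', h'⟩ := Module.FinitePresentation.exists_isPresentation R M₂
    rw [rk.moduleDim_eq h, rk.moduleDim_eq h', rk.moduleDim_eq (h.prod h'), rank_fromBlocks_diag,
      Fintype.card_sum, Nat.cast_add]
    ring
  dim_exact M₁ M₂ M₃ _ _ _ _ _ _ _ _ _ f g hfg hg := by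
    obtain ⟨n₁, m₁, A₁, p₁, h₁⟩ := Module.FinitePresentation.exists_isPresentation R M₁
    obtain ⟨n₂, m₂, A₂, p₂, h₂⟩ := Module.FinitePresentation.exists_isPresentation R M₂
    obtain ⟨n₃, m₃, A₃, p₃, h₃⟩ := Module.FinitePresentation.exists_isPresentation R M₃
    rw [rk.moduleDim_eq h₁, rk.moduleDim_eq h₂, rk.moduleDim_eq h₃]
    exact ⟨rk.card_sub_rank_le_add h₁ h₂ h₃ hfg hg, rk.card_sub_rank_le h₂ h₃ hg⟩

theorem isAssociated_toModuleRank : rk.IsAssociated rk.toModuleRank := fun n m A ↦ by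
  change rk.rk A = m - rk.moduleDim _
  rw [rk.moduleDim_eq (PresentedModule.isPresentation A), rank_fin, Fintype.card_fin]
  ring

/-- A matrix rank function is determined by its associated module rank function. -/
theorem eq_of_isAssociated {rk rk' : SylvesterMatrixRank R} {d : SylvesterModuleRank R}
    (h : rk.IsAssociated d) (h' : rk'.IsAssociated d) : rk = rk' := by
  ext m n A
  rw [h, h']

end SylvesterMatrixRank

end MatrixRank

/-! ### Existence: normalized length over an artinian ring -/

section Length

set_option linter.unusedSectionVars false

open Matrix

variable (R : Type u) [Ring R] [IsArtinianRing R] [IsNoetherianRing R]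

/-- The length of a module, as a real number. -/
noncomputable def Module.realLength (M : Type*) [AddCommGroup M] [Module R M] : ℝ :=
  ((Module.length R M).toNat : ℝ)

variable {R} {M N P : Type*} [AddCommGroup M] [Module R M] [AddCommGroup N] [Module R N]
  [AddCommGroup P] [Module R P] [Module.Finite R M] [Module.Finite R N] [Module.Finite R P]

theorem Module.realLength_le_of_injective {f : M →ₗ[R] N} (hf : Function.Injective f) :
    Module.realLength R M ≤ Module.realLength R N :=
  -- `toNat` sends infinity to 0, so finiteness of the larger length is essential here.
  Nat.cast_le.mpr (ENat.toNat_le_toNat (Module.length_le_of_injective f hf) Module.length_ne_top)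

theorem Module.realLength_le_of_surjective {f : M →ₗ[R] N} (hf : Function.Surjective f) :
    Module.realLength R N ≤ Module.realLength R M :=
  Nat.cast_le.mpr (ENat.toNat_le_toNat (Module.length_le_of_surjective f hf) Module.length_ne_top)

theorem Module.realLength_prod :
    Module.realLength R (M × N) = Module.realLength R M + Module.realLength R N := by
  rw [realLength, Module.length_prod, ENat.toNat_add Module.length_ne_top Module.length_ne_top,
    Nat.cast_add, realLength, realLength]

theorem Module.realLength_add_le {f : M →ₗ[R] N} {g : N →ₗ[R] P} (hf : Function.Injective f)
    (hg : Function.Surjective g) (hgf : g ∘ₗ f = 0) :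
    Module.realLength R M + Module.realLength R P ≤ Module.realLength R N := by
  have h1 := Module.realLength_le_of_injective (f := f.codRestrict (LinearMap.ker g)
    fun x ↦ LinearMap.congr_fun hgf x) fun x y hxy ↦ hf (congrArg Subtype.val hxy)
  have h2 := Module.length_eq_add_of_exact (LinearMap.ker g).subtype g
    (LinearMap.ker g).injective_subtype hg (LinearMap.exact_subtype_ker_map g)
  have h3 : Module.realLength R N =
      Module.realLength R (LinearMap.ker g) + Module.realLength R P := by
    rw [realLength, h2, ENat.toNat_add Module.length_ne_top Module.length_ne_top, Nat.cast_add,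
      realLength, realLength]
  linarith

variable {ι κ ι' κ' : Type*} [Fintype ι] [Fintype κ] [Fintype ι'] [Fintype κ']

/-- The length of the row space of a matrix. -/
noncomputable def Matrix.rowLength (A : Matrix ι κ R) : ℝ :=
  Module.realLength R (LinearMap.range A.vecMulLinear)

theorem Matrix.rowLength_zero : (0 : Matrix ι κ R).rowLength = 0 := by
  have : LinearMap.range (0 : Matrix ι κ R).vecMulLinear = ⊥ := by
    rw [LinearMap.range_eq_bot]
    ext
    simp
  rw [rowLength, this, Module.realLength, Module.length_bot]
  simp

theorem Matrix.rowLength_mul_le_left (A : Matrix ι κ R) (B : Matrix κ κ' R) :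
    (A * B).rowLength ≤ A.rowLength := by
  refine Module.realLength_le_of_surjective (f := B.vecMulLinear.restrict
    (p := LinearMap.range A.vecMulLinear) (q := LinearMap.range (A * B).vecMulLinear) ?_) ?_
  · rintro _ ⟨x, rfl⟩
    exact ⟨x, by simp⟩
  · rintro ⟨_, x, rfl⟩
    exact ⟨⟨_, x, rfl⟩, Subtype.ext (by simp [LinearMap.restrict_apply])⟩

theorem Matrix.rowLength_mul_le_right (A : Matrix ι κ R) (B : Matrix κ κ' R) :
    (A * B).rowLength ≤ B.rowLength := by
  refine Module.realLength_le_of_injective (f := Submodule.inclusion ?_)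
    (Submodule.inclusion_injective _)
  rintro _ ⟨x, rfl⟩
  exact ⟨x ᵥ* A, by simp⟩

theorem Matrix.rowLength_submatrix_le (A : Matrix ι κ R) (e : ι' ≃ ι) (f : κ' ≃ κ) :
    (A.submatrix e f).rowLength ≤ A.rowLength := by
  classical
  have h : A.submatrix e f = (1 : Matrix ι ι R).submatrix e id * A *
      (1 : Matrix κ κ R).submatrix id f := by
    ext i j
    simp [Matrix.mul_apply, Matrix.one_apply]
  rw [h]
  exact (rowLength_mul_le_left _ _).trans (rowLength_mul_le_right _ _)

theorem Matrix.rowLength_submatrix (A : Matrix ι κ R) (e : ι' ≃ ι) (f : κ' ≃ κ) :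
    (A.submatrix e f).rowLength = A.rowLength := by
  refine le_antisymm (A.rowLength_submatrix_le e f) ?_
  simpa using (A.submatrix e f).rowLength_submatrix_le e.symm f.symm

theorem Matrix.rowLength_add_le (A : Matrix ι κ R) (B : Matrix ι' κ' R) (C : Matrix ι κ' R) :
    A.rowLength + B.rowLength ≤ (fromBlocks A C 0 B).rowLength := by
  rw [add_comm]
  refine Module.realLength_add_le
    (f := ((LinearEquiv.sumArrowLequivProdArrow κ κ' R R).symm.toLinearMap ∘ₗ
      LinearMap.inr R (κ → R) (κ' → R)).restrict ?_)
    (g := (LinearMap.funLeft R R Sum.inl).restrict ?_) ?_ ?_ ?_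
  · rintro _ ⟨x, rfl⟩
    refine ⟨Sum.elim 0 x, ?_⟩
    rw [vecMulLinear_apply, vecMul_fromBlocks]
    ext (i | i) <;> simp
  · rintro _ ⟨x, rfl⟩
    exact ⟨x ∘ Sum.inl, by ext i; simp [vecMul_fromBlocks, LinearMap.funLeft_apply]⟩
  · intro x y hxy
    ext i
    exact congrFun (congrArg Subtype.val hxy) (Sum.inr i)
  · rintro ⟨_, x, rfl⟩
    refine ⟨⟨_, Sum.elim x 0, rfl⟩, Subtype.ext ?_⟩
    ext i
    simp [LinearMap.restrict_apply, vecMul_fromBlocks, LinearMap.funLeft_apply]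
  · ext x i
    rfl

theorem Matrix.rowLength_diag (A : Matrix ι κ R) (B : Matrix ι' κ' R) :
    (fromBlocks A 0 0 B).rowLength = A.rowLength + B.rowLength := by
  refine le_antisymm ?_ (A.rowLength_add_le B 0)
  rw [rowLength, rowLength, rowLength, ← Module.realLength_prod]
  refine Module.realLength_le_of_injective
    (f := ((LinearMap.funLeft R R Sum.inl).restrict ?_).prod
      ((LinearMap.funLeft R R Sum.inr).restrict ?_)) ?_
  · rintro _ ⟨x, rfl⟩
    exact ⟨x ∘ Sum.inl, by ext i; simp [vecMul_fromBlocks, LinearMap.funLeft_apply]⟩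
  · rintro _ ⟨x, rfl⟩
    exact ⟨x ∘ Sum.inr, by ext i; simp [vecMul_fromBlocks, LinearMap.funLeft_apply]⟩
  · intro x y hxy
    obtain ⟨h1, h2⟩ := Prod.ext_iff.mp hxy
    ext (i | i)
    · exact congrFun (congrArg Subtype.val h1) i
    · exact congrFun (congrArg Subtype.val h2) i

theorem Matrix.rowLength_one [DecidableEq ι] [Unique ι] :
    (1 : Matrix ι ι R).rowLength = Module.realLength R R := by
  have h : LinearMap.range (1 : Matrix ι ι R).vecMulLinear = ⊤ :=
    LinearMap.range_eq_top.mpr fun x ↦ ⟨x, by simp⟩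
  rw [rowLength, h, Module.realLength, Module.length_top,
    (LinearEquiv.funUnique ι R R).length_eq, Module.realLength]

variable (R) in
theorem Module.realLength_self_ne_zero [Nontrivial R] : Module.realLength R R ≠ 0 := by
  rw [realLength, Nat.cast_ne_zero, Ne, ENat.toNat_eq_zero, not_or]
  exact ⟨Module.length_pos.ne', Module.length_ne_top⟩

variable (R) in
/-- The normalized length of the row space is a matrix rank function on an artinian ring. -/
noncomputable def SylvesterMatrixRank.ofLength [Nontrivial R] : SylvesterMatrixRank R where
  rk A := A.rowLength / Module.realLength R R
  nonneg A := div_nonneg (Nat.cast_nonneg _) (Nat.cast_nonneg _)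
  rk_zero m n := by rw [rowLength_zero, zero_div]
  rk_one := by rw [rowLength_one, div_self (Module.realLength_self_ne_zero R)]
  rk_mul_le A B := le_min
    (div_le_div_of_nonneg_right (A.rowLength_mul_le_left B) (Nat.cast_nonneg _))
    (div_le_div_of_nonneg_right (A.rowLength_mul_le_right B) (Nat.cast_nonneg _))
  rk_diag A B := by
    rw [reindex_apply, rowLength_submatrix, rowLength_diag, add_div]
  rk_triangular A B C := by
    rw [reindex_apply, rowLength_submatrix, ← add_div]
    exact div_le_div_of_nonneg_right (A.rowLength_add_le B C) (Nat.cast_nonneg _)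

end Length

/-! ### Uniqueness of rank functions -/

section Uniqueness

attribute [local instance] Module.finitePresentation_of_finite

namespace SylvesterModuleRank

section General

variable {R : Type u} [Ring R] (d : SylvesterModuleRank R) {M N : Type u} [AddCommGroup M]
  [Module R M] [AddCommGroup N] [Module R N]

theorem dim_congr [Module.FinitePresentation R M] [Module.FinitePresentation R N]
    (e : M ≃ₗ[R] N) : d.dim M = d.dim N := by
  have h := d.dim_exact PUnit.{u + 1} M N 0 e.toLinearMap
    (fun x ↦ by simpa using eq_comm) e.surjective
  have h0 := d.dim_zero
  linarith

theorem dim_pi (n : ℕ) : d.dim (Fin n → R) = n := by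
  induction n with
  | zero =>
    rw [d.dim_congr (0 : (Fin 0 → R) ≃ₗ[R] PUnit.{u + 1}), d.dim_zero, Nat.cast_zero]
  | succ n ih =>
    rw [← d.dim_congr (Fin.consLinearEquiv R fun _ ↦ R), d.dim_prod, d.dim_self, ih]
    push_cast
    ring

variable [IsNoetherianRing R] [Module.Finite R M] [Module.Finite R N]

theorem dim_le_of_surjective {f : M →ₗ[R] N} (hf : Function.Surjective f) :
    d.dim N ≤ d.dim M :=
  (d.dim_exact _ _ _ _ f (LinearMap.exact_subtype_ker_map f) hf).2

theorem dim_le_ker_add {f : M →ₗ[R] N} (hf : Function.Surjective f) :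
    d.dim M ≤ d.dim (LinearMap.ker f) + d.dim N :=
  (d.dim_exact _ _ _ _ f (LinearMap.exact_subtype_ker_map f) hf).1

theorem dim_le_add_quotient (L : Submodule R M) : d.dim M ≤ d.dim L + d.dim (M ⧸ L) :=
  (d.dim_exact _ _ _ _ L.mkQ (LinearMap.exact_subtype_mkQ L) L.mkQ_surjective).1

theorem dim_sup_of_disjoint {C K : Submodule R M} (h : Disjoint C K) :
    d.dim (C ⊔ K : Submodule R M) = d.dim C + d.dim K := by
  have hinj : Function.Injective (C.subtype.coprod K.subtype) := by
    rw [← LinearMap.ker_eq_bot, LinearMap.ker_coprod_of_disjoint_range]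
    · simp
    · simpa using h
  have hrange : LinearMap.range (C.subtype.coprod K.subtype) = C ⊔ K := by
    rw [LinearMap.range_coprod, Submodule.range_subtype, Submodule.range_subtype]
  rw [← d.dim_prod, d.dim_congr ((LinearEquiv.ofInjective _ hinj).trans (LinearEquiv.ofEq _ _ hrange))]

end General

variable {R : Type u} [Ring R] [IsSimpleRing R] [IsNoetherianRing R]
  (d : SylvesterModuleRank R) {M N : Type u} [AddCommGroup M] [Module R M] [AddCommGroup N]
  [Module R N] [Module.Finite R M] [Module.Finite R N]

/-- Choose `m` with `J m` nonzero and put `J' = J ∩ ann m`. Then `R ⧸ J'` embeds in `(R ⧸ J) × M`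
with cokernel `M ⧸ J m`, which has dimension zero by `hM`. -/
theorem exists_essential_dim_quotient_add_le [Nontrivial M]
    (hM : ∀ L : Submodule R M, L ≠ ⊥ → d.dim (M ⧸ L) = 0) (hs : Module.Singular R M)
    {J : Ideal R} (hJ : J.Essential) :
    ∃ J' : Ideal R, J'.Essential ∧ d.dim (R ⧸ J) + d.dim M ≤ d.dim (R ⧸ J') := by
  have hJ0 : J ≠ ⊥ := by
    rintro rfl
    obtain ⟨r, hr, hr'⟩ := hJ 1 one_ne_zero
    exact hr hr'
  obtain ⟨a, ha, m, -, ham⟩ := IsSimpleRing.exists_smul_ne_zero hJ0 (top_ne_bot (α := Submodule R M))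
  let ρ := LinearMap.toSpanSingleton R M m
  let L : Submodule R M := Submodule.map ρ J
  have hL : L ≠ ⊥ := fun h ↦ ham (by
    have : a • m ∈ L := ⟨a, ha, rfl⟩
    rwa [h, Submodule.mem_bot] at this)
  let F : R →ₗ[R] (R ⧸ J) × M := J.mkQ.prod ρ
  let g : (R ⧸ J) × M →ₗ[R] M ⧸ L :=
    (J.liftQ (L.mkQ ∘ₗ ρ) fun r hr ↦ by
      exact (Submodule.Quotient.mk_eq_zero L).mpr ⟨r, hr, rfl⟩).coprod (-L.mkQ)
  have hg : ∀ r x, g (J.mkQ r, x) = L.mkQ (ρ r - x) := fun r x ↦ by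
    change L.mkQ (ρ r) + -L.mkQ x = _
    rw [map_sub, sub_eq_add_neg]
  have hgs : Function.Surjective g := fun y ↦ by
    obtain ⟨x, rfl⟩ := L.mkQ_surjective y
    exact ⟨(J.mkQ 0, -x), by rw [hg]; simp⟩
  have hexact : Function.Exact ((LinearMap.ker F).liftQ F le_rfl) g := by
    rintro ⟨y, x⟩
    obtain ⟨r, rfl⟩ := J.mkQ_surjective y
    rw [hg]
    constructor
    · intro h
      obtain ⟨b, hb, hbx⟩ := (Submodule.Quotient.mk_eq_zero L).mp h
      refine ⟨Submodule.Quotient.mk (r - b), Prod.ext ?_ ?_⟩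
      · change J.mkQ (r - b) = J.mkQ r
        have : J.mkQ b = 0 := (Submodule.Quotient.mk_eq_zero J).mpr hb
        rw [map_sub, this, sub_zero]
      · change ρ (r - b) = x
        rw [map_sub, hbx, sub_sub_cancel]
    · rintro ⟨q, hq⟩
      obtain ⟨t, rfl⟩ := Submodule.mkQ_surjective _ q
      obtain ⟨h1, h2⟩ : J.mkQ t = J.mkQ r ∧ ρ t = x := Prod.ext_iff.mp hq
      refine (Submodule.Quotient.mk_eq_zero L).mpr ⟨r - t, ?_, ?_⟩
      · exact (Submodule.Quotient.eq J).mp h1.symm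
      · rw [map_sub, h2]
  have h := (d.dim_exact _ _ _ _ g hexact hgs).1
  rw [hM L hL, add_zero, d.dim_prod] at h
  refine ⟨LinearMap.ker F, ?_, h⟩
  rw [LinearMap.ker_prod, Submodule.ker_mkQ]
  exact hJ.inf (hs m)

theorem dim_eq_zero_of_singular (hs : Module.Singular R M) : d.dim M = 0 := by
  by_contra hM
  -- Passing to `M ⧸ L` makes every proper quotient have dimension zero.
  obtain ⟨L, hL, hmax⟩ := set_has_maximal_iff_noetherian.mpr (inferInstance : IsNoetherian R M)
    {L | d.dim (M ⧸ L) ≠ 0}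
    ⟨⊥, fun h ↦ hM ((d.dim_congr (Submodule.quotEquivOfEqBot ⊥ rfl)).symm.trans h)⟩
  have hcrit : ∀ K : Submodule R (M ⧸ L), K ≠ ⊥ → d.dim ((M ⧸ L) ⧸ K) = 0 := by
    intro K hK
    by_contra hne
    refine hmax (LinearMap.ker (K.mkQ ∘ₗ L.mkQ)) (fun h ↦ hne ?_) ?_
    · rw [← h]
      exact (d.dim_congr (LinearMap.quotKerEquivOfSurjective (K.mkQ ∘ₗ L.mkQ)
        (K.mkQ_surjective.comp L.mkQ_surjective))).symm
    · rw [LinearMap.ker_comp, Submodule.ker_mkQ]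
      refine lt_of_le_of_ne (fun x hx ↦ ?_) fun h ↦ hK ?_
      · have : L.mkQ x = 0 := (Submodule.Quotient.mk_eq_zero L).mpr hx
        rw [Submodule.mem_comap, this]
        exact K.zero_mem
      · rw [← Submodule.map_comap_eq_of_surjective L.mkQ_surjective K, ← h, Submodule.mkQ_map_self]
  have hnt : Nontrivial (M ⧸ L) := by
    by_contra hnt
    rw [not_nontrivial_iff_subsingleton] at hnt
    exact hL ((d.dim_congr (0 : (M ⧸ L) ≃ₗ[R] PUnit.{u + 1})).trans d.dim_zero)
  have key : ∀ k : ℕ, ∃ J : Ideal R, J.Essential ∧ k * d.dim (M ⧸ L) ≤ d.dim (R ⧸ J) := by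
    intro k
    induction k with
    | zero => exact ⟨⊤, fun m hm ↦ ⟨1, by simpa using hm, trivial⟩, by simpa using d.nonneg _⟩
    | succ k ih =>
      obtain ⟨J, hJ, hk⟩ := ih
      obtain ⟨J', hJ', h⟩ :=
        d.exists_essential_dim_quotient_add_le hcrit (hs.of_surjective L.mkQ_surjective) hJ
      refine ⟨J', hJ', ?_⟩
      push_cast
      linarith
  have hpos : 0 < d.dim (M ⧸ L) := lt_of_le_of_ne (d.nonneg _) (Ne.symm hL)
  obtain ⟨k, hk⟩ := exists_nat_gt (1 / d.dim (M ⧸ L))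
  obtain ⟨J, -, hJ⟩ := key k
  have h1 := d.dim_le_of_surjective J.mkQ_surjective
  rw [d.dim_self] at h1
  rw [div_lt_iff₀ hpos] at hk
  linarith

theorem dim_le_of_singular_quotient {L : Submodule R M} (h : Module.Singular R (M ⧸ L)) :
    d.dim M ≤ d.dim L := by
  simpa [d.dim_eq_zero_of_singular h] using d.dim_le_add_quotient L

theorem dim_le_of_essential_range {f : M →ₗ[R] N} (hf : (LinearMap.range f).Essential) :
    d.dim N ≤ d.dim M :=
  (d.dim_le_of_singular_quotient hf.singular_quotient).trans
    (d.dim_le_of_surjective f.surjective_rangeRestrict)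

/-- `dim` is not assumed monotone on submodules, so the upper bound needs regular elements: one on
each coordinate axis inside `C` gives a diagonal embedding of `R^n` in `C` with essential range. -/
theorem dim_eq_of_essential {n : ℕ} {C : Submodule R (Fin n → R)} (hC : C.Essential) :
    d.dim C = n := by
  refine le_antisymm ?_ ?_
  · choose s hs hs' using fun i : Fin n ↦
      (hC.comap (LinearMap.single R (fun _ ↦ R) i)).exists_mem_nonZeroDivisors
    let F : (Fin n → R) →ₗ[R] (Fin n → R) :=
      LinearMap.pi fun i ↦ LinearMap.toSpanSingleton R R (s i) ∘ₗ LinearMap.proj i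
    have hF : Function.Injective F := fun x y hxy ↦ funext fun i ↦
      injective_toSpanSingleton_of_mem_nonZeroDivisors (hs' i) (congrFun hxy i)
    have hFC : ∀ x, F x ∈ C := fun x ↦ by
      rw [pi_eq_sum_univ' (F x)]
      refine C.sum_mem fun i _ ↦ ?_
      have h := C.smul_mem (x i) (hs i)
      convert h using 1
      ext j
      simp [F, Pi.single_apply, eq_comm]
    rw [← d.dim_pi n]
    refine d.dim_le_of_essential_range (f := F.codRestrict C hFC) ?_
    rw [LinearMap.range_codRestrict]
    exact (LinearMap.essential_range_of_injective hF).comap _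
  · rw [← d.dim_pi n]
    exact d.dim_le_of_singular_quotient hC.singular_quotient

/-- A common complement `K` makes both `C ⊔ K` and `D ⊔ K` essential in `R^n`, of dimension `n`;
cancel `d.dim K`. -/
theorem dim_eq_of_essential_comap {n : ℕ} {D C : Submodule R (Fin n → R)} (hDC : D ≤ C)
    (h : (D.comap C.subtype).Essential) : d.dim D = d.dim C := by
  obtain ⟨K, hK, hess⟩ := C.exists_disjoint_sup_essential
  have hess' : (D ⊔ K).Essential := by
    intro x hx
    obtain ⟨r, hr, hrx⟩ := hess x hx
    obtain ⟨c, hc, k, hk, hck⟩ := Submodule.mem_sup.mp hrx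
    by_cases hc0 : c = 0
    · refine ⟨r, hr, ?_⟩
      rw [← hck, hc0, zero_add]
      exact Submodule.mem_sup_right hk
    · obtain ⟨t, ht, htD⟩ := h ⟨c, hc⟩ fun h ↦ hc0 (congrArg Subtype.val h)
      refine ⟨t * r, fun h0 ↦ ht (Subtype.ext ?_), ?_⟩
      · rw [mul_smul, ← hck, smul_add] at h0
        refine Submodule.disjoint_def.mp hK _ (C.smul_mem t hc) ?_
        change t • c ∈ K
        rw [eq_neg_of_add_eq_zero_left h0]
        exact K.neg_mem (K.smul_mem t hk)
      · rw [mul_smul, ← hck, smul_add]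
        exact Submodule.add_mem_sup htD (K.smul_mem t hk)
  have h1 := d.dim_eq_of_essential hess
  have h2 := d.dim_eq_of_essential hess'
  rw [d.dim_sup_of_disjoint hK] at h1
  rw [d.dim_sup_of_disjoint (hK.mono_left hDC)] at h2
  linarith

/-- A maximal `D` in `C` with this property is essential in `C`, since otherwise another copy of `U`
could be added as a direct summand. The order of quantifiers matters: one `k` serves all `d`. -/
theorem exists_dim_submodule_eq_mul {U : Ideal R} (hU : U ≠ ⊥)
    (hunif : ∀ A : Submodule R U, A ≠ ⊥ → A.Essential) {n : ℕ} (C : Submodule R (Fin n → R)) :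
    ∃ k : ℕ, ∀ d : SylvesterModuleRank R, d.dim C = k * d.dim U := by
  obtain ⟨D, ⟨hDC, k, hk⟩, hmax⟩ := set_has_maximal_iff_noetherian.mpr
    (inferInstance : IsNoetherian R (Fin n → R))
    {D | D ≤ C ∧ ∃ k : ℕ, ∀ d : SylvesterModuleRank R, d.dim D = k * d.dim U}
    ⟨⊥, bot_le, 0, fun d ↦ by
      rw [d.dim_congr (0 : (⊥ : Submodule R (Fin n → R)) ≃ₗ[R] PUnit.{u + 1}), d.dim_zero,
        Nat.cast_zero, zero_mul]⟩
  by_cases hess : (D.comap C.subtype).Essential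
  · exact ⟨k, fun d ↦ (d.dim_eq_of_essential_comap hDC hess).symm.trans (hk d)⟩
  exfalso
  obtain ⟨L, hDL, hL⟩ : ∃ L, Disjoint (D.comap C.subtype) L ∧ L ≠ ⊥ := by
    by_contra! hc
    exact hess (Submodule.essential_of_forall_disjoint hc)
  obtain ⟨a, ha, l, hl, hal⟩ := IsSimpleRing.exists_smul_ne_zero hU hL
  let f : U →ₗ[R] (Fin n → R) := LinearMap.toSpanSingleton R _ (l : Fin n → R) ∘ₗ U.subtype
  have hf0 : f ≠ 0 := fun h ↦ hal (Subtype.ext (LinearMap.congr_fun h ⟨a, ha⟩))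
  have hf : Function.Injective f :=
    (IsSimpleRing.nonsingular R).pi.injective_of_uniform hunif hf0
  have hdisj : Disjoint D (LinearMap.range f) := by
    rw [Submodule.disjoint_def]
    rintro _ hx ⟨t, rfl⟩
    exact congrArg Subtype.val
      (Submodule.disjoint_def.mp hDL ((t : R) • l) hx (L.smul_mem _ hl))
  refine hmax (D ⊔ LinearMap.range f) ⟨sup_le hDC ?_, k + 1, fun d ↦ ?_⟩ ?_
  · rintro _ ⟨t, rfl⟩
    exact C.smul_mem _ l.2
  · rw [d.dim_sup_of_disjoint hdisj, hk, ← d.dim_congr (LinearEquiv.ofInjective f hf)]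
    push_cast
    ring
  · refine lt_of_le_of_ne le_sup_left fun h ↦ hf0 (LinearMap.range_eq_bot.mp ?_)
    exact disjoint_self.mp (hdisj.mono_left (by rw [h]; exact le_sup_right))

theorem exists_dim_eq_mul {U : Ideal R} (hU : U ≠ ⊥)
    (hunif : ∀ A : Submodule R U, A ≠ ⊥ → A.Essential) (M : Type u) [AddCommGroup M] [Module R M]
    [Module.Finite R M] : ∃ k : ℕ, ∀ d : SylvesterModuleRank R, d.dim M = k * d.dim U := by
  obtain ⟨n, p, hp⟩ := Module.Finite.exists_fin' R M
  -- `C` replaces `M`: its image has singular cokernel, and `d.dim C` and `d.dim (ker p)` add up to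
  -- `n`.
  obtain ⟨C, hC, hess⟩ := (LinearMap.ker p).exists_disjoint_sup_essential
  obtain ⟨k, hk⟩ := exists_dim_submodule_eq_mul hU hunif C
  refine ⟨k, fun d ↦ ?_⟩
  rw [← hk]
  refine le_antisymm ?_ ?_
  · have hsing : Module.Singular R (M ⧸ C.map p) := by
      refine hess.singular_quotient.of_surjective
        (f := Submodule.liftQ _ ((C.map p).mkQ ∘ₗ p) (sup_le (fun x hx ↦ ?_) fun x hx ↦ ?_)) ?_
      · have : p x = 0 := hx
        simp [this]
      · exact (Submodule.Quotient.mk_eq_zero _).mpr (Submodule.mem_map_of_mem hx)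
      · intro y
        obtain ⟨x, rfl⟩ := ((C.map p).mkQ_surjective.comp hp) y
        exact ⟨Submodule.Quotient.mk x, rfl⟩
    exact (d.dim_le_of_singular_quotient hsing).trans
      (d.dim_le_of_surjective (p.submoduleMap_surjective C))
  · have h1 := d.dim_eq_of_essential hess
    have h2 := d.dim_le_ker_add hp
    rw [d.dim_sup_of_disjoint hC] at h1
    rw [d.dim_pi] at h2
    linarith

/-- A simple left noetherian ring has at most one module rank function. -/
instance subsingleton_of_isSimpleRing : Subsingleton (SylvesterModuleRank R) := by
  refine ⟨fun d d' ↦ ?_⟩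
  obtain ⟨U, hU, hunif⟩ := exists_uniform_ideal R
  obtain ⟨k₀, hk₀⟩ := exists_dim_eq_mul hU hunif R
  have hdim : d.dim U = d'.dim U := by
    have h := hk₀ d
    have h' := hk₀ d'
    rw [d.dim_self] at h
    rw [d'.dim_self] at h'
    have hne : (k₀ : ℝ) ≠ 0 := fun h0 ↦ by simp [h0] at h
    exact mul_left_cancel₀ hne (h.symm.trans h')
  ext M _ _ _
  obtain ⟨k, hk⟩ := exists_dim_eq_mul hU hunif M
  rw [hk, hk, hdim]

end SylvesterModuleRank

/-- A simple left noetherian ring has at most one matrix rank function. -/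
instance SylvesterMatrixRank.subsingleton_of_isSimpleRing {R : Type u} [Ring R] [IsSimpleRing R]
    [IsNoetherianRing R] : Subsingleton (SylvesterMatrixRank R) :=
  ⟨fun rk rk' ↦ eq_of_isAssociated rk.isAssociated_toModuleRank
    (Subsingleton.elim rk'.toModuleRank rk.toModuleRank ▸ rk'.isAssociated_toModuleRank)⟩

end Uniqueness

theorem mainTheorem3 (R : Type u) [Ring R] [IsNoetherianRing R] [IsSimpleRing R] :
    Nonempty (OreLocalization.OreSet R⁰) ∧
    ∀ [OreLocalization.OreSet R⁰],
      IsSimpleRing (ClassicalLeftQuotientRing R) ∧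
      IsArtinianRing (ClassicalLeftQuotientRing R) ∧
      ∃ (rkQ : SylvesterMatrixRank (ClassicalLeftQuotientRing R))
        (dimQ : SylvesterModuleRank (ClassicalLeftQuotientRing R))
        (dimR : SylvesterModuleRank R),
        (Set.univ : Set (SylvesterMatrixRank (ClassicalLeftQuotientRing R))) = {rkQ} ∧
        (Set.univ : Set (SylvesterModuleRank (ClassicalLeftQuotientRing R))) = {dimQ} ∧
        rkQ.IsAssociated dimQ ∧
        (Set.univ : Set (SylvesterMatrixRank R)) =
          {rkQ.comap OreLocalization.numeratorRingHom} ∧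
        (Set.univ : Set (SylvesterModuleRank R)) = {dimR} ∧
        (rkQ.comap OreLocalization.numeratorRingHom).IsAssociated dimR := by
  refine ⟨IsSimpleRing.nonempty_oreSet R, ?_⟩
  intro _
  let rkQ := SylvesterMatrixRank.ofLength (ClassicalLeftQuotientRing R)
  let rkR := rkQ.comap (OreLocalization.numeratorRingHom : R →+* ClassicalLeftQuotientRing R)
  exact ⟨inferInstance, inferInstance, rkQ, rkQ.toModuleRank, rkR.toModuleRank,
    Set.eq_singleton_iff_unique_mem.mpr ⟨trivial, fun _ _ ↦ Subsingleton.elim _ _⟩,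
    Set.eq_singleton_iff_unique_mem.mpr ⟨trivial, fun _ _ ↦ Subsingleton.elim _ _⟩,
    rkQ.isAssociated_toModuleRank,
    Set.eq_singleton_iff_unique_mem.mpr ⟨trivial, fun _ _ ↦ Subsingleton.elim _ _⟩,
    Set.eq_singleton_iff_unique_mem.mpr ⟨trivial, fun _ _ ↦ Subsingleton.elim _ _⟩,
    rkR.isAssociated_toModuleRank⟩
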